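/- Let $V$ be a complex vector space. For a set $\mathcal G$ of operators (linear maps $V\to V$) put $\mathcal G^{[0]}=\mathcal G$ and $\mathcal G^{[k]}=\{AB-BA : A\in\mathcal G^{[k-1]},\ B\in\mathcal G\}$ for $k\ge 1$; $\mathcal G$ is *L-nilpotent* if $\mathcal G^{[k]}\subseteq\{0\}$ for some $k$, and *locally L-nilpotent* if each of its finite subsets is L-nilpotent. An operator $T$ is *algebraic* if $p(T)=0$ for some nonzero complex polynomial $p$. Let $\mathcal F$ be a locally L-nilpotent set of algebraic operators on $V$, and let $\mathcal A$ be the (not necessarily unital) associative algebra generated by $\mathcal F$. Let $J(\mathcal A)$ be the Jacobson radical of $\mathcal A$, that is, the intersection of all primitive ideals of $\mathcal A$, where a primitive ideal is the annihilator of a simple left $\mathcal A$-module $M$ ($\mathcal A M\ne 0$ and $M$ has no submodules other than $0$ and $M$); if there are no primitive ideals, $J(\mathcal A)=\mathcal A$. Then: (a) $\mathcal A$ is locally finite: every finitely generated subalgebra of $\mathcal A$ is finite-dimensional. (b) $\mathcal A/J(\mathcal A)$ is commutative. (c) $J(\mathcal A)=\{T\in\mathcal A : T \text{ is nilpotent}\}$.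 (d) $\mathcal A$ is algebraically triangularizable: there is a chain of subspaces of $V$, maximal among all chains of subspaces of $V$, each member of which is invariant under every operator in $\mathcal A$. -/

import Mathlib

/-- The sets `F^[k]` of iterated commutators of a set `F` of elements of a ring:
`F^[0] = F` and `F^[k+1] = {[A, B] = A * B - B * A : A ∈ F^[k], B ∈ F}`. -/
def iteratedCommutators {R : Type*} [Ring R] (F : Set R) : ℕ → Set R
  | 0 => F
  | k + 1 => {C | ∃ A ∈ iteratedCommutators F k, ∃ B ∈ F, C = A * B - B * A}

/-- `F` is L-nilpotent if every element of `F^[k]` is zero, for some `k`.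
(For nonempty `F` this says `F^[k] = {0}`; the empty set counts as L-nilpotent.) -/
def IsLNilpotent {R : Type*} [Ring R] (F : Set R) : Prop :=
  ∃ k : ℕ, iteratedCommutators F k ⊆ {0}

/-- `F` is locally L-nilpotent if all its finite subsets are L-nilpotent. -/
def IsLocallyLNilpotent {R : Type*} [Ring R] (F : Set R) : Prop :=
  ∀ G : Set R, G ⊆ F → G.Finite → IsLNilpotent G

/-- An algebra (not necessarily unital) is locally finite if each of its finitely generated
subalgebras is finite-dimensional. -/
def IsLocallyFiniteAlgebra (K A : Type*) [Field K] [NonUnitalRing A] [Module K A]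
    [IsScalarTower K A A] [SMulCommClass K A A] : Prop :=
  ∀ B : NonUnitalSubalgebra K A,
    (∃ s : Set A, s.Finite ∧ NonUnitalAlgebra.adjoin K s = B) → FiniteDimensional K B

/-- The left `A`-module `M` given by `π` is simple: `A M ≠ 0`, and the only submodules of `M`
are `0` and `M`. The first condition matters because `A` need not have an identity; it forces
`M ≠ 0`. -/
def IsSimpleRepresentation {K A M : Type*} [Field K] [NonUnitalRing A] [Module K A]
    [AddCommGroup M] [Module K M] (π : A →ₙₐ[K] Module.End K M) : Prop :=
  (∃ (a : A) (m : M), π a m ≠ 0) ∧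
    ∀ N : Submodule K M, (∀ a : A, ∀ m ∈ N, π a m ∈ N) → N = ⊥ ∨ N = ⊤

/-- A two-sided ideal of the `K`-algebra `A` is (left) primitive if it is the annihilator of a
simple left `A`-module. Every simple module is a quotient of `A` (it equals `A m` for any nonzero
`m` in it), so modules in the universe of `A` suffice. -/
def IsPrimitiveIdeal.{v, u} (K : Type v) {A : Type u} [Field K] [NonUnitalRing A] [Module K A]
    (P : TwoSidedIdeal A) : Prop :=
  ∃ (M : Type u) (_ : AddCommGroup M) (_ : Module K M) (π : A →ₙₐ[K] Module.End K M),
    IsSimpleRepresentation π ∧ ∀ a : A, a ∈ P ↔ π a = 0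

/-- The Jacobson radical: the intersection of all primitive ideals (the whole algebra if there
are none). -/
def jacobsonRadical (K A : Type*) [Field K] [NonUnitalRing A] [Module K A] : TwoSidedIdeal A :=
  sInf {P : TwoSidedIdeal A | IsPrimitiveIdeal K P}

/-- A family of operators on `V` is algebraically triangularizable if some maximal chain of
subspaces of `V` consists of subspaces that are invariant under the family. -/
def IsAlgebraicallyTriangularizable {K V : Type*} [Field K] [AddCommGroup V] [Module K V]
    (F : Set (Module.End K V)) : Prop :=
  ∃ C : Set (Submodule K V), IsMaxChain (· ≤ ·) C ∧
    ∀ M ∈ C, ∀ T ∈ F, ∀ x ∈ M, T x ∈ M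

open Polynomial

/-! Everything rests on finite subsets `G` of `F`. Split each `t ∈ G` as `t = s + n`, with `s` a
polynomial in `t` killed by a separable polynomial and `n` nilpotent. L-nilpotency makes `ad t`
nilpotent on `G`, which forces `s` to commute with `G`. So the semisimple parts generate a central,
finite-dimensional algebra `C`, and over `C` the algebra of `G` is generated by the parts `n`. These
are again L-nilpotent, and finitely many L-nilpotent nilpotents span a nilpotent `C`-module `W`
(`isNilpotent_span_of_iteratedCommutators`). Hence the algebra is finite-dimensional, and it equals
`C · 1` plus a nilpotent ideal containing all commutators.

Consequently the nilpotents of `A` absorb left multiplication, are closed under sums and contain all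
commutators (`IsAlmostCommutative`). They act as zero on every gap between neighbouring invariant
subspaces, where `A` therefore acts by scalars (`exists_scalar`). This makes a maximal chain of
invariant subspaces maximal among all subspaces. It also yields, for each non-nilpotent `a`, a
character not vanishing at `a`, so the radical contains only nilpotents; conversely nilpotents kill
every simple module. -/

/-! ### Commutator identities and nilpotent commutators -/

theorem pow_mul_sub_mul_pow {R : Type*} [Ring R] {s h : R} (hc : Commute s (s * h - h * s))
    (n : ℕ) : s ^ (n + 1) * h - h * s ^ (n + 1) = (n + 1 : ℕ) • (s ^ n * (s * h - h * s)) := by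
  induction n with
  | zero => simp
  | succ n ih =>
    have h1 : s ^ (n + 1 + 1) * h - h * s ^ (n + 1 + 1)
        = s * (s ^ (n + 1) * h - h * s ^ (n + 1)) + (s * h - h * s) * s ^ (n + 1) := by
      rw [pow_succ' s (n + 1)]; noncomm_ring
    rw [h1, ih, ← (hc.pow_left (n + 1)).eq, mul_smul_comm, ← mul_assoc, ← pow_succ', ← succ_nsmul]

theorem aeval_mul_sub_mul_aeval {K R : Type*} [CommRing K] [Ring R] [Algebra K R] {s h : R}
    (hc : Commute s (s * h - h * s)) (q : K[X]) :
    aeval s q * h - h * aeval s q = aeval s (derivative q) * (s * h - h * s) := by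
  induction q using Polynomial.induction_on' with
  | add p q hp hq =>
    simp only [map_add, add_mul, mul_add, ← hp, ← hq]
    abel
  | monomial n a =>
    cases n with
    | zero => simp [Algebra.commutes a h]
    | succ n =>
      have := congrArg (fun x => algebraMap K R a * x) (pow_mul_sub_mul_pow hc n)
      simp only [mul_sub, ← mul_assoc] at this
      rw [Algebra.commutes a h, mul_assoc h] at this
      rw [derivative_monomial, aeval_monomial, aeval_monomial, this]
      simp only [Nat.add_sub_cancel, map_mul, map_natCast, nsmul_eq_mul, mul_sub, mul_assoc]

/-- A weak form of the Kleinecke–Shirokov argument: bracketing `b ^ (j + 1) * z ^ i = 0` with `a`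
trades one factor `b` for one factor `z`, up to the invertible integer `j + 1`. -/
theorem isNilpotent_commutator {C R : Type*} [CommRing C] (hC : ∀ n : ℕ, n ≠ 0 → IsUnit (n : C))
    [Ring R] [Algebra C R] {a b : R} (hb : IsNilpotent b) (ha : Commute a (a * b - b * a))
    (hb' : Commute b (a * b - b * a)) : IsNilpotent (a * b - b * a) := by
  set z := a * b - b * a with hz
  have hba : b * a - a * b = -z := by rw [hz]; abel
  have key : ∀ j i : ℕ, b ^ j * z ^ i = 0 → z ^ (i + j) = 0 := by
    intro j
    induction j with
    | zero => intro i h; simpa using h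
    | succ j ih =>
      intro i h
      have h1 := pow_mul_sub_mul_pow (s := b) (h := a) (by rw [hba]; exact hb'.neg_right) j
      have h2 := congrArg (· * z ^ i) h1
      simp only [sub_mul] at h2
      rw [mul_assoc, (ha.pow_right i).eq, ← mul_assoc, h, zero_mul, mul_assoc, h, mul_zero,
        sub_zero, hba] at h2
      have h3 : ((j + 1 : ℕ) : C) • (b ^ j * z ^ (i + 1)) = 0 := by
        rw [Nat.cast_smul_eq_nsmul, ← neg_eq_zero, pow_succ', ← mul_assoc, ← smul_neg,
          ← neg_mul, ← mul_neg, ← smul_mul_assoc, ← h2]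
      have h4 := (hC (j + 1) j.succ_ne_zero).smul_eq_zero.1 h3
      have := ih (i + 1) h4
      rwa [show i + (j + 1) = i + 1 + j by omega]
  obtain ⟨m, hm⟩ := hb
  exact ⟨0 + m, key m 0 (by simp [hm])⟩

/-! ### L-nilpotent sets of nilpotent elements -/

theorem image_iteratedCommutators {R S : Type*} [Ring R] [Ring S] (f : R →+* S) (G : Set R)
    (k : ℕ) : f '' iteratedCommutators G k = iteratedCommutators (f '' G) k := by
  induction k with
  | zero => rfl
  | succ k ih =>
    simp only [iteratedCommutators, ← ih]
    ext x
    constructor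
    · rintro ⟨_, ⟨a, ha, b, hb, rfl⟩, rfl⟩
      exact ⟨f a, ⟨a, ha, rfl⟩, f b, ⟨b, hb, rfl⟩, by simp⟩
    · rintro ⟨_, ⟨a, ha, rfl⟩, _, ⟨b, hb, rfl⟩, rfl⟩
      exact ⟨_, ⟨a, ha, b, hb, rfl⟩, by simp⟩

theorem finite_iteratedCommutators {R : Type*} [Ring R] {G : Set R} (hG : G.Finite) (k : ℕ) :
    (iteratedCommutators G k).Finite := by
  induction k with
  | zero => exact hG
  | succ k ih =>
    refine ((ih.prod hG).image fun p => p.1 * p.2 - p.2 * p.1).subset ?_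
    rintro _ ⟨a, ha, b, hb, rfl⟩
    exact ⟨(a, b), ⟨ha, hb⟩, rfl⟩

theorem commute_of_adjoin_eq_top {C R : Type*} [CommRing C] [Ring R] [Algebra C R] {G : Set R}
    (hG : Algebra.adjoin C G = ⊤) {z : R} (hz : ∀ g ∈ G, Commute z g) (x : R) : Commute z x := by
  have hx : x ∈ Algebra.adjoin C G := hG ▸ Algebra.mem_top
  induction hx using Algebra.adjoin_induction with
  | mem x hx => exact hz x hx
  | algebraMap r => exact Algebra.commute_algebraMap_right r z
  | add x y _ _ hx hy => exact hx.add_right hy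
  | mul x y _ _ hx hy => exact hx.mul_right hy

/-- In the semiring of submodules the span lies in a finite sum of commuting nilpotent lines. -/
theorem isNilpotent_span_of_commute {C R : Type*} [CommRing C] [Ring R] [Algebra C R] {Z : Set R}
    (hfin : Z.Finite) (hnil : ∀ z ∈ Z, IsNilpotent z) (hcomm : ∀ z ∈ Z, ∀ x : R, Commute z x) :
    IsNilpotent (Submodule.span C Z) := by
  have h : Submodule.span C Z ≤ ∑ z ∈ hfin.toFinset, Submodule.span C {z} := by
    refine Submodule.span_le.2 fun z hz => ?_
    have h1 : Submodule.span C {z} ≤ ∑ z ∈ hfin.toFinset, Submodule.span C {z} :=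
      Finset.single_le_sum (f := fun z : R => Submodule.span C {z}) (fun _ _ => bot_le)
        (hfin.mem_toFinset.2 hz)
    exact h1 (Submodule.mem_span_singleton_self z)
  suffices hn : IsNilpotent (∑ z ∈ hfin.toFinset, Submodule.span C {z}) by
    obtain ⟨n, hn⟩ := hn
    refine ⟨n, le_bot_iff.1 ?_⟩
    have h1 := pow_le_pow_left' h n
    rw [hn] at h1
    exact h1
  refine Commute.isNilpotent_sum (fun z hz => ?_) (fun z w hz hw => ?_)
  · obtain ⟨n, hn⟩ := hnil z (by simpa using hz)
    refine ⟨n, ?_⟩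
    rw [Submodule.span_pow, Set.singleton_pow, hn]
    simp
  · rw [commute_iff_eq, Submodule.span_mul_span, Submodule.span_mul_span]
    simp [(hcomm z (by simpa using hz) w).eq]

/-- Induction on `k`: the last layer `Z` is central, so it consists of nilpotents and generates a
nilpotent ideal; modulo that ideal the length drops by one. -/
theorem isNilpotent_span_of_iteratedCommutators {C : Type*} [CommRing C]
    (hC : ∀ n : ℕ, n ≠ 0 → IsUnit (n : C)) (k : ℕ) {R : Type*} [Ring R] [Algebra C R] {G : Set R}
    (hfin : G.Finite) (hnil : ∀ g ∈ G, IsNilpotent g) (hk : iteratedCommutators G k ⊆ {0})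
    (htop : Algebra.adjoin C G = ⊤) : IsNilpotent (Submodule.span C G) := by
  induction k generalizing R with
  | zero =>
    refine ⟨1, ?_⟩
    rw [pow_one]
    exact Submodule.span_eq_bot.2 fun x hx => hk hx
  | succ k ih =>
    set Z := iteratedCommutators G k with hZ
    have hcomm : ∀ z ∈ Z, ∀ x : R, Commute z x := fun z hz =>
      commute_of_adjoin_eq_top htop fun g hg => sub_eq_zero.1 (hk ⟨z, hz, g, hg, rfl⟩)
    have hZnil : ∀ z ∈ Z, IsNilpotent z := by
      intro z hz
      -- The layer `Z` is `G` itself when `k = 0`; otherwise its members are central commutators.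
      cases k with
      | zero => exact hnil z hz
      | succ k =>
        obtain ⟨a, ha, b, hb, rfl⟩ := hz
        exact isNilpotent_commutator hC (hnil b hb) (hcomm _ ⟨a, ha, b, hb, rfl⟩ a).symm
          (hcomm _ ⟨a, ha, b, hb, rfl⟩ b).symm
    obtain ⟨r, hr⟩ := isNilpotent_span_of_commute (C := C)
      (finite_iteratedCommutators hfin k) hZnil hcomm
    let I : Ideal R := Ideal.span Z
    have hI : I.IsTwoSided := by
      refine ⟨fun {a} b ha => ?_⟩
      induction ha using Submodule.span_induction with
      | mem x hx => rw [(hcomm x hx b).eq]; exact I.mul_mem_left b (Ideal.subset_span hx)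
      | zero => simp
      | add x y _ _ hx hy => rw [add_mul]; exact I.add_mem hx hy
      | smul c x _ hx => rw [smul_eq_mul, mul_assoc]; exact I.mul_mem_left c hx
    let f : R →ₐ[C] R ⧸ I := Ideal.Quotient.mkₐ C I
    have hf : Function.Surjective f := Ideal.Quotient.mkₐ_surjective C I
    obtain ⟨m, hm⟩ := ih (G := f '' G) (hfin.image f)
      (by rintro _ ⟨g, hg, rfl⟩; exact (hnil g hg).map f)
      (by
        have := image_iteratedCommutators (f : R →+* R ⧸ I) G k
        rw [AlgHom.coe_toRingHom] at this
        rw [← this]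
        rintro _ ⟨z, hz, rfl⟩
        exact Ideal.Quotient.eq_zero_iff_mem.2 (Ideal.subset_span hz))
      (by rw [← AlgHom.map_adjoin, htop, Algebra.map_top]; exact (AlgHom.range_eq_top f).2 hf)
    have hle : ∀ x ∈ I, x ∈ (⊤ : Submodule C R) * Submodule.span C Z := by
      intro x hx
      induction hx using Submodule.span_induction with
      | mem x hx =>
        rw [← one_mul x]
        exact Submodule.mul_mem_mul Submodule.mem_top (Submodule.subset_span hx)
      | zero => exact zero_mem _
      | add x y _ _ hx hy => exact add_mem hx hy
      | smul c x _ hx =>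
        have h1 := Submodule.mul_mem_mul (Submodule.mem_top (x := c)) hx
        rw [← mul_assoc] at h1
        have h2 := mul_le_mul_left (le_top : (⊤ : Submodule C R) * ⊤ ≤ ⊤) (Submodule.span C Z)
        exact h2 h1
    have hpow : Submodule.span C G ^ m ≤ ⊤ * Submodule.span C Z := by
      intro x hx
      have h1 : f x ∈ Submodule.map f.toLinearMap (Submodule.span C G ^ m) := ⟨x, hx, rfl⟩
      rw [Submodule.map_pow, Submodule.map_span] at h1
      have h2 : f x = 0 := by
        have h3 : (⇑f.toLinearMap '' G) = f '' G := rfl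
        rw [h3, hm] at h1
        exact h1
      exact hle x (Ideal.Quotient.eq_zero_iff_mem.1 h2)
    have hc : Commute (⊤ : Submodule C R) (Submodule.span C Z) := by
      rw [commute_iff_eq, ← Submodule.span_univ, Submodule.span_mul_span, Submodule.span_mul_span]
      congr 1
      ext x
      simp only [Set.mem_mul, Set.mem_univ, true_and]
      constructor
      · rintro ⟨a, z, hz, rfl⟩
        exact ⟨z, hz, a, (hcomm z hz a).eq⟩
      · rintro ⟨z, hz, a, rfl⟩
        exact ⟨a, z, hz, (hcomm z hz a).eq.symm⟩
    -- The power `m` lands in `⊤ * span Z`, whose `r`-th power vanishes because the two factors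
    -- commute.
    refine ⟨m * r, ?_⟩
    rw [pow_mul]
    refine le_bot_iff.1 ?_
    refine (pow_le_pow_left' hpow r).trans ?_
    rw [hc.mul_pow, hr, mul_zero]
    exact le_rfl

/-! ### Semisimple parts and their centrality -/

/-- Jordan–Chevalley by Newton iteration: for `q` the squarefree part of an annihilating polynomial,
`q(t)` is nilpotent and `q'(t)` is invertible in `K[t]`. -/
theorem exists_isNilpotent_sub_aeval_eq_zero {K R : Type*} [Field K] [CharZero K] [Ring R]
    [Algebra K R] {t : R} (ht : IsAlgebraic K t) :
    ∃ s ∈ Algebra.adjoin K {t}, IsNilpotent (t - s) ∧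
      ∃ q : K[X], q.Separable ∧ aeval s q = 0 := by
  obtain ⟨p, hp0, hp⟩ := ht
  obtain ⟨q, k, hq, -, c, hc⟩ := exists_squarefree_dvd_pow_of_ne_zero hp0
  rw [← PerfectField.separable_iff_squarefree] at hq
  let x : Algebra.adjoin K {t} := ⟨t, Algebra.self_mem_adjoin_singleton K t⟩
  have hqk : aeval t (q ^ k) = 0 := by rw [hc, map_mul, hp, zero_mul]
  have nil : IsNilpotent (aeval x q) := by
    refine ⟨k, ?_⟩
    rw [← map_pow, Subtype.ext_iff, coe_aeval_mk_apply, hqk]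
    rfl
  have unit : IsUnit (aeval x (derivative q)) := by
    obtain ⟨a, b, h⟩ : IsCoprime (q ^ k) (derivative q) := hq.pow_left
    have h1 := congrArg (aeval x) h
    have h2 : aeval x (q ^ k) = 0 := by
      rw [Subtype.ext_iff, coe_aeval_mk_apply, hqk]
      rfl
    rw [map_add, map_mul, map_mul, h2, mul_zero, zero_add, map_one] at h1
    exact .of_mul_eq_one_right _ h1
  obtain ⟨⟨s, hs⟩, ⟨⟨n, hn⟩, hsq⟩, -⟩ := existsUnique_nilpotent_sub_and_aeval_eq_zero nil unit
  refine ⟨s, hs, ⟨n, ?_⟩, q, hq, ?_⟩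
  · rw [Subtype.ext_iff] at hn
    simpa [x] using hn
  · rwa [Subtype.ext_iff, coe_aeval_mk_apply] at hsq

/-- Bracketing `q(s) = 0` with `h` gives `q'(s) [s, h] = 0`, and separability makes `q'(s)`
invertible. -/
theorem commute_of_commute_commutator {K R : Type*} [Field K] [Ring R] [Algebra K R] {s h : R}
    {q : K[X]} (hq : q.Separable) (hs : aeval s q = 0) (hc : Commute s (s * h - h * s)) :
    Commute s h := by
  have h1 := aeval_mul_sub_mul_aeval hc q
  rw [hs, zero_mul, mul_zero, sub_zero] at h1
  obtain ⟨a, b, hab⟩ := hq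
  have h2 := congrArg (aeval s) hab
  rw [map_add, map_mul, map_mul, hs, mul_zero, zero_add, map_one] at h2
  rw [commute_iff_eq, ← sub_eq_zero, ← one_mul (s * h - h * s), ← h2, mul_assoc, ← h1, mul_zero]

/-- The inner derivation of an algebra given by an element. -/
def innerDer (K : Type*) {R : Type*} [Field K] [Ring R] [Algebra K R] (t : R) : Module.End K R :=
  LinearMap.mulLeft K t - LinearMap.mulRight K t

theorem innerDer_apply {K R : Type*} [Field K] [Ring R] [Algebra K R] (t x : R) :
    innerDer K t x = t * x - x * t := rfl

/-- Since `ad s` differs from `ad t` by a commuting nilpotent, some power of `ad s` kills `g`;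
semisimplicity of `s` then lowers that power to one. -/
theorem commute_of_innerDer_pow_apply {K R : Type*} [Field K] [Ring R] [Algebra K R] {t s g : R}
    (hs : s ∈ Algebra.adjoin K {t}) (hts : IsNilpotent (t - s)) {q : K[X]} (hq : q.Separable)
    (hsq : aeval s q = 0) {k : ℕ} (hk : (innerDer K t ^ k) g = 0) : Commute s g := by
  have hcomm : Commute t s := Algebra.commute_of_mem_adjoin_singleton_of_commute hs rfl
  have hDc : Commute (innerDer K (s - t)) (innerDer K t) := by
    ext x
    simp only [Module.End.mul_apply, innerDer_apply, mul_sub, sub_mul, ← mul_assoc]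
    simp only [mul_assoc, hcomm.eq]
    noncomm_ring
  have hnil : IsNilpotent (innerDer K (s - t)) := by
    have hst : IsNilpotent (s - t) := by rw [← neg_sub]; exact hts.neg
    refine (LinearMap.commute_mulLeft_right _ _).isNilpotent_sub ?_ ?_
    · exact (LinearMap.isNilpotent_mulLeft_iff K _).2 hst
    · exact (LinearMap.isNilpotent_mulRight_iff K _).2 hst
  obtain ⟨m, hm⟩ := hnil
  have hD : innerDer K s = innerDer K (s - t) + innerDer K t := by
    ext x
    simp only [LinearMap.add_apply, innerDer_apply]
    noncomm_ring
  have hM : (innerDer K s ^ (m + k)) g = 0 := by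
    rw [hD, hDc.add_pow, LinearMap.sum_apply]
    refine Finset.sum_eq_zero fun i hi => ?_
    -- Each binomial term has at least `m` factors `ad (s - t)` or at least `k` factors `ad t`.
    rcases le_or_gt m i with h | h
    · rw [pow_eq_zero_of_le h hm, zero_mul, zero_mul, LinearMap.zero_apply]
    · obtain ⟨j, hj⟩ : ∃ j, m + k - i = j + k := ⟨m - i, by omega⟩
      rw [hj, ← Nat.cast_comm, Module.End.mul_apply, Module.End.mul_apply, pow_add,
        Module.End.mul_apply, hk, map_zero, map_zero, map_zero]
  have key : ∀ j : ℕ, (innerDer K s ^ (j + 1)) g = 0 → innerDer K s g = 0 := by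
    intro j
    induction j with
    | zero => simp
    | succ j ih =>
      intro h
      refine ih ?_
      rw [pow_succ', Module.End.mul_apply, innerDer_apply, sub_eq_zero]
      refine commute_of_commute_commutator hq hsq (sub_eq_zero.1 ?_)
      rw [pow_succ', pow_succ', Module.End.mul_apply, Module.End.mul_apply] at h
      exact h
  refine sub_eq_zero.1 (key (m + k) ?_)
  rw [pow_succ', Module.End.mul_apply, hM, map_zero]

/-! ### Algebras generated by nilpotents over a commutative base -/

/-- A ring has enough nilpotents if its nilpotent elements form a left ideal that contains all
commutators. -/
structure HasEnoughNilpotents (R : Type*) [Ring R] : Prop where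
  comm (x y : R) : IsNilpotent (x * y - y * x)
  add {x y : R} : IsNilpotent x → IsNilpotent y → IsNilpotent (x + y)
  mul_left (x : R) {y : R} : IsNilpotent y → IsNilpotent (x * y)

/-- Nilpotency can be tested in the commutative quotient by the nil ideal `I`. -/
theorem HasEnoughNilpotents.of_ideal {R : Type*} [Ring R] (I : Ideal R) [I.IsTwoSided]
    (hI : ∀ x ∈ I, IsNilpotent x) (hc : ∀ x y : R, x * y - y * x ∈ I) :
    HasEnoughNilpotents R := by
  have hcomm : ∀ a b : R ⧸ I, Commute a b := by
    intro a b
    obtain ⟨x, rfl⟩ := Ideal.Quotient.mk_surjective a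
    obtain ⟨y, rfl⟩ := Ideal.Quotient.mk_surjective b
    rw [commute_iff_eq, ← map_mul, ← map_mul]
    exact Ideal.Quotient.eq.2 (hc x y)
  have hmk : ∀ x : R, IsNilpotent (Ideal.Quotient.mk I x) → IsNilpotent x := by
    rintro x ⟨n, hn⟩
    rw [← map_pow] at hn
    obtain ⟨m, hm⟩ := hI _ (Ideal.Quotient.eq_zero_iff_mem.1 hn)
    exact ⟨n * m, by rw [pow_mul, hm]⟩
  refine ⟨fun x y => hI _ (hc x y), fun {x y} hx hy => hmk _ ?_, fun x {y} hy => hmk _ ?_⟩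
  · rw [map_add]
    exact (hcomm _ _).isNilpotent_add (hx.map _) (hy.map _)
  · rw [map_mul]
    exact (hcomm _ _).isNilpotent_mul_left (hy.map _)

section NilpotentGenerators

variable {C R : Type*} [CommRing C] [Ring R] [Algebra C R] {N : Set R}

theorem exists_sum_pow_span_eq_top (htop : Algebra.adjoin C N = ⊤)
    (hN : IsNilpotent (Submodule.span C N)) :
    ∃ m : ℕ, ∑ i ∈ Finset.range m, Submodule.span C N ^ i = ⊤ := by
  obtain ⟨m, hm⟩ := hN
  set W := Submodule.span C N with hW
  have hle : ∀ i < m + 1, W ^ i ≤ ∑ i ∈ Finset.range (m + 1), W ^ i := fun i hi =>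
    Finset.single_le_sum (f := fun i => W ^ i) (fun _ _ => bot_le) (Finset.mem_range.2 hi)
  have hmul : W * ∑ i ∈ Finset.range (m + 1), W ^ i ≤ ∑ i ∈ Finset.range (m + 1), W ^ i := by
    rw [Finset.mul_sum]
    conv_lhs => rw [Finset.sum_range_succ, ← pow_succ', pow_succ, hm, zero_mul, add_zero]
    rw [Finset.sum_range_succ']
    simp only [pow_succ']
    exact le_self_add
  -- The sum of powers is a left ideal; it contains `1`, hence everything.
  have key : ∀ x : R, ∀ u ∈ ∑ i ∈ Finset.range (m + 1), W ^ i,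
      x * u ∈ ∑ i ∈ Finset.range (m + 1), W ^ i := by
    intro x
    have hx : x ∈ Algebra.adjoin C N := htop ▸ Algebra.mem_top
    induction hx using Algebra.adjoin_induction with
    | mem x hx => exact fun u hu => hmul (Submodule.mul_mem_mul (Submodule.subset_span hx) hu)
    | algebraMap r =>
      intro u hu
      rw [← Algebra.smul_def]
      exact Submodule.smul_mem _ r hu
    | add x y _ _ hx hy =>
      intro u hu
      rw [add_mul]
      exact add_mem (hx u hu) (hy u hu)
    | mul x y _ _ hx hy =>
      intro u hu
      rw [mul_assoc]
      exact hx _ (hy u hu)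
  refine ⟨m + 1, Submodule.eq_top_iff'.2 fun x => ?_⟩
  rw [← mul_one x]
  refine key x 1 (hle 0 m.succ_pos ?_)
  rw [pow_zero]
  exact Submodule.one_le.1 le_rfl

theorem finite_of_isNilpotent_span (hfin : N.Finite) (htop : Algebra.adjoin C N = ⊤)
    (hN : IsNilpotent (Submodule.span C N)) : Module.Finite C R := by
  obtain ⟨m, hm⟩ := exists_sum_pow_span_eq_top htop hN
  refine ⟨hm ▸ Finset.sum_induction _ Submodule.FG (fun a b ha hb => ha.sup hb)
    Submodule.fg_bot fun i _ => (Submodule.fg_span hfin).pow i⟩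

/-- The ideal `I = R W` is nilpotent, and `R = C · 1 + I`; subtracting scalars leaves commutators
unchanged, so they lie in `I`. -/
theorem hasEnoughNilpotents_of_isNilpotent_span (htop : Algebra.adjoin C N = ⊤)
    (hN : IsNilpotent (Submodule.span C N)) : HasEnoughNilpotents R := by
  obtain ⟨m, hm⟩ := exists_sum_pow_span_eq_top htop hN
  obtain ⟨n, hn⟩ := hN
  set W := Submodule.span C N with hW
  have hcomm : Commute (⊤ : Submodule C R) W := by
    rw [← hm]
    exact Commute.sum_left _ _ _ fun i _ => (Commute.refl W).pow_left i
  have htt : (⊤ : Submodule C R) * ⊤ ≤ ⊤ := le_top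
  let I : Ideal R :=
    { (⊤ * W : Submodule C R) with
      smul_mem' := fun c x hx => by
        have h1 := Submodule.mul_mem_mul (Submodule.mem_top (x := c) (R := C)) hx
        rw [← mul_assoc] at h1
        exact mul_le_mul_left htt W h1 }
  have hI : ∀ x, x ∈ I ↔ x ∈ (⊤ * W : Submodule C R) := fun x => Iff.rfl
  have hI2 : I.IsTwoSided := by
    refine ⟨fun {a} b ha => ?_⟩
    have h1 := Submodule.mul_mem_mul ((hI a).1 ha) (Submodule.mem_top (x := b) (R := C))
    rw [mul_assoc, ← hcomm.eq, ← mul_assoc] at h1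
    exact mul_le_mul_left htt W h1
  have hdec : ∀ x : R, ∃ c : C, x - algebraMap C R c ∈ I := by
    intro x
    have h1 : (⊤ : Submodule C R) ≤ 1 ⊔ ⊤ * W := by
      rw [← hm]
      refine Finset.sum_induction _ (fun a => a ≤ 1 ⊔ _ * W) (fun a b ha hb => sup_le ha hb)
        bot_le fun i _ => ?_
      cases i with
      | zero => exact le_sup_left
      | succ i =>
        rw [hm, pow_succ]
        exact le_sup_of_le_right (mul_le_mul_left le_top W)
    obtain ⟨y, hy, z, hz, rfl⟩ := Submodule.mem_sup.1 (h1 (Submodule.mem_top (x := x)))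
    obtain ⟨c, rfl⟩ := Submodule.mem_one.1 hy
    exact ⟨c, by rwa [add_sub_cancel_left]⟩
  refine HasEnoughNilpotents.of_ideal I (fun x hx => ⟨n, ?_⟩) fun x y => ?_
  · have h1 := Submodule.pow_mem_pow _ ((hI x).1 hx) n
    rw [hcomm.mul_pow, hn, mul_zero] at h1
    exact h1
  · obtain ⟨c, hc⟩ := hdec x
    obtain ⟨d, hd⟩ := hdec y
    have h1 : x * y - y * x = (x - algebraMap C R c) * (y - algebraMap C R d)
        - (y - algebraMap C R d) * (x - algebraMap C R c) := by
      have h2 := Algebra.commutes c y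
      have h3 := Algebra.commutes d x
      have h4 := Algebra.commutes c (algebraMap C R d)
      simp only [sub_mul, mul_sub, h2, h3, h4]
      abel
    rw [h1]
    exact I.sub_mem (I.mul_mem_left _ hd) (I.mul_mem_left _ hc)

end NilpotentGenerators

/-! ### Splitting off the central semisimple parts -/

theorem iteratedCommutators_succ_subset_of_central {R : Type*} [Ring R] {G : Set R} {s : R → R}
    (hs : ∀ g ∈ G, ∀ x : R, Commute (s g) x) (k : ℕ) :
    iteratedCommutators ((fun g => g - s g) '' G) (k + 1) ⊆ iteratedCommutators G (k + 1) := by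
  have key : ∀ g ∈ G, ∀ a : R, a * (g - s g) - (g - s g) * a = a * g - g * a := by
    intro g hg a
    rw [mul_sub, sub_mul, (hs g hg a).eq]
    abel
  induction k with
  | zero =>
    rintro _ ⟨_, ⟨a, ha, rfl⟩, _, ⟨b, hb, rfl⟩, rfl⟩
    refine ⟨a, ha, b, hb, ?_⟩
    simp only [key b hb]
    rw [sub_mul, mul_sub, (hs a ha b).eq]
    abel
  | succ k ih =>
    rintro _ ⟨a, ha, _, ⟨b, hb, rfl⟩, rfl⟩
    exact ⟨a, ih ha, b, hb, key b hb a⟩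

/-- Iterated commutators bracket on the right, which is `-ad t`; hence the sign. -/
theorem innerDer_pow_apply_mem {K R : Type*} [Field K] [Ring R] [Algebra K R] {G : Set R} {t g : R}
    (ht : t ∈ G) (hg : g ∈ G) (k : ℕ) :
    ∃ c ∈ iteratedCommutators G k, (innerDer K t ^ k) g = c ∨ (innerDer K t ^ k) g = -c := by
  induction k with
  | zero => exact ⟨g, hg, Or.inl rfl⟩
  | succ k ih =>
    obtain ⟨c, hc, h⟩ := ih
    refine ⟨c * t - t * c, ⟨c, hc, t, ht, rfl⟩, ?_⟩
    rw [pow_succ', Module.End.mul_apply, innerDer_apply]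
    rcases h with h | h
    · right
      rw [h]
      abel
    · left
      rw [h]
      noncomm_ring

theorem exists_central_sub_isNilpotent {K R : Type*} [Field K] [CharZero K] [Ring R] [Algebra K R]
    {G : Set R} (htop : Algebra.adjoin K G = ⊤) (halg : ∀ g ∈ G, IsAlgebraic K g)
    (hL : IsLNilpotent G) :
    ∀ t ∈ G, ∃ s : R, (∀ x, Commute s x) ∧ IsNilpotent (t - s) ∧ IsIntegral K s := by
  intro t ht
  obtain ⟨k, hk⟩ := hL
  obtain ⟨s, hs, hnil, q, hq, hsq⟩ := exists_isNilpotent_sub_aeval_eq_zero (halg t ht)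
  refine ⟨s, commute_of_adjoin_eq_top htop fun g hg => ?_, hnil,
    (isAlgebraic_iff_isIntegral).1 ⟨q, hq.ne_zero, hsq⟩⟩
  obtain ⟨c, hc, h⟩ := innerDer_pow_apply_mem (K := K) ht hg k
  refine commute_of_innerDer_pow_apply hs hnil hq hsq (k := k) ?_
  have hc0 : c = 0 := hk hc
  simpa [hc0] using h

theorem finite_and_hasEnoughNilpotents_of_central {K C R : Type*} [Field K] [CharZero K]
    [CommRing C] [Ring R] [Algebra K C] [Module.Finite K C] [Algebra C R] [Algebra K R]
    [IsScalarTower K C R] {G : Set R} (hfin : G.Finite) (htop : Algebra.adjoin K G = ⊤)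
    (hL : IsLNilpotent G) {s : R → R} (hs : ∀ g ∈ G, s g ∈ (algebraMap C R).range)
    (hnil : ∀ g ∈ G, IsNilpotent (g - s g)) : Module.Finite K R ∧ HasEnoughNilpotents R := by
  let N : Set R := (fun g => g - s g) '' G
  have hNtop : Algebra.adjoin C N = ⊤ := by
    have h1 : Algebra.adjoin K G ≤ (Algebra.adjoin C N).restrictScalars K := by
      refine Algebra.adjoin_le fun g hg => ?_
      obtain ⟨c, hc⟩ := hs g hg
      have h4 : s g ∈ Algebra.adjoin C N := hc ▸ Subalgebra.algebraMap_mem _ c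
      have h5 : g - s g ∈ Algebra.adjoin C N := Algebra.subset_adjoin ⟨g, hg, rfl⟩
      have := add_mem h5 h4
      rwa [sub_add_cancel] at this
    rw [htop] at h1
    exact eq_top_iff.2 fun x _ => h1 Algebra.mem_top
  have hC : ∀ n : ℕ, n ≠ 0 → IsUnit (n : C) := by
    intro n hn
    have := (IsUnit.mk0 (n : K) (Nat.cast_ne_zero.2 hn)).map (algebraMap K C)
    rwa [map_natCast] at this
  obtain ⟨k, hk⟩ := hL
  have hW : IsNilpotent (Submodule.span C N) := by
    -- Layer `0` changes when central parts are subtracted, so vanishing is carried over only at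
    -- layer `k + 1`.
    refine isNilpotent_span_of_iteratedCommutators hC (k + 1) (hfin.image _) ?_ ?_ hNtop
    · rintro _ ⟨g, hg, rfl⟩
      exact hnil g hg
    · refine (iteratedCommutators_succ_subset_of_central (fun g hg x => ?_) k).trans ?_
      · obtain ⟨c, hc⟩ := hs g hg
        exact hc ▸ Algebra.commutes c x
      · rintro _ ⟨a, ha, b, -, rfl⟩
        have ha0 : a = 0 := hk ha
        simp [ha0]
  have hfinC : Module.Finite C R := finite_of_isNilpotent_span (hfin.image _) hNtop hW
  exact ⟨Module.Finite.trans C R, hasEnoughNilpotents_of_isNilpotent_span hNtop hW⟩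

theorem finite_and_hasEnoughNilpotents_of_isLNilpotent {K R : Type*} [Field K] [CharZero K]
    [Ring R] [Algebra K R] {G : Set R} (hfin : G.Finite) (htop : Algebra.adjoin K G = ⊤)
    (halg : ∀ g ∈ G, IsAlgebraic K g) (hL : IsLNilpotent G) :
    Module.Finite K R ∧ HasEnoughNilpotents R := by
  choose! s hs hnil hint using exists_central_sub_isNilpotent htop halg hL
  -- Generating `C` inside the centre makes it a commutative ring over which `R` is an algebra.
  let Z := Subalgebra.center K R
  let S : Set Z := Subtype.val ⁻¹' (s '' G)
  have hS : S.Finite := (hfin.image s).preimage Subtype.val_injective.injOn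
  let C := Algebra.adjoin K S
  have hCfin : Module.Finite K C := by
    refine Module.Finite.iff_fg.2 (fg_adjoin_of_finite hS ?_)
    rintro x ⟨g, hg, hgx⟩
    have := hint g hg
    rw [hgx] at this
    exact (isIntegral_algHom_iff Z.val Subtype.val_injective).1 this
  let inst : Algebra C R := (Z.val.comp C.val : C →+* R).toAlgebra' fun c x =>
    ((Subalgebra.mem_center_iff.1 (c : Z).2) x).symm
  refine @finite_and_hasEnoughNilpotents_of_central K C R _ _ _ _ _ _ inst _
    (@IsScalarTower.of_algebraMap_eq K C R _ _ _ _ inst _ fun _ => rfl) G hfin htop hL s ?_ hnil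
  intro g hg
  have h2 : s g ∈ Z := Subalgebra.mem_center_iff.2 fun x => (hs g hg x).eq.symm
  have h3 : (⟨s g, h2⟩ : Z) ∈ C := Algebra.subset_adjoin ⟨g, hg, rfl⟩
  exact ⟨⟨_, h3⟩, rfl⟩

/-! ### From finite subsets to the whole algebra -/

theorem exists_finite_subset_mem_adjoin {K R : Type*} [CommSemiring K] [Semiring R] [Algebra K R]
    {F : Set R} {x : R} (hx : x ∈ Algebra.adjoin K F) :
    ∃ G ⊆ F, G.Finite ∧ x ∈ Algebra.adjoin K G := by
  induction hx using Algebra.adjoin_induction with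
  | mem x hx =>
    exact ⟨{x}, Set.singleton_subset_iff.2 hx, Set.finite_singleton x,
      Algebra.self_mem_adjoin_singleton K x⟩
  | algebraMap r => exact ⟨∅, Set.empty_subset F, Set.finite_empty, Subalgebra.algebraMap_mem _ r⟩
  | add x y _ _ hx hy =>
    obtain ⟨G, hGF, hG, hx⟩ := hx
    obtain ⟨H, hHF, hH, hy⟩ := hy
    exact ⟨G ∪ H, Set.union_subset hGF hHF, hG.union hH,
      add_mem (Algebra.adjoin_mono Set.subset_union_left hx)
        (Algebra.adjoin_mono Set.subset_union_right hy)⟩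
  | mul x y _ _ hx hy =>
    obtain ⟨G, hGF, hG, hx⟩ := hx
    obtain ⟨H, hHF, hH, hy⟩ := hy
    exact ⟨G ∪ H, Set.union_subset hGF hHF, hG.union hH,
      mul_mem (Algebra.adjoin_mono Set.subset_union_left hx)
        (Algebra.adjoin_mono Set.subset_union_right hy)⟩

theorem exists_finite_subset_subset_adjoin {K R : Type*} [CommSemiring K] [Semiring R]
    [Algebra K R] {F s : Set R} (hs : s.Finite) (hsF : s ⊆ Algebra.adjoin K F) :
    ∃ G ⊆ F, G.Finite ∧ s ⊆ Algebra.adjoin K G := by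
  choose! G hGF hG hxG using fun x (hx : x ∈ s) => exists_finite_subset_mem_adjoin (hsF hx)
  exact ⟨⋃ x ∈ s, G x, Set.iUnion₂_subset hGF, hs.biUnion hG,
    fun x hx => Algebra.adjoin_mono (Set.subset_biUnion_of_mem hx) (hxG x hx)⟩

section LNilpotent

variable {K R : Type*} [Field K] [Ring R] [Algebra K R]

theorem finite_and_hasEnoughNilpotents_adjoin [CharZero K] {G : Set R} (hfin : G.Finite)
    (halg : ∀ g ∈ G, IsAlgebraic K g) (hL : IsLNilpotent G) :
    Module.Finite K (Algebra.adjoin K G) ∧ HasEnoughNilpotents (Algebra.adjoin K G) := by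
  have himg : (Subtype.val : Algebra.adjoin K G → R) '' (Subtype.val ⁻¹' G) = G := by
    refine Set.image_preimage_eq_of_subset ?_
    rw [Subtype.range_coe]
    exact Algebra.subset_adjoin
  refine finite_and_hasEnoughNilpotents_of_isLNilpotent (K := K)
    (G := (Subtype.val : Algebra.adjoin K G → R) ⁻¹' G) (hfin.preimage Subtype.val_injective.injOn)
    Algebra.adjoin_adjoin_coe_preimage (fun g hg => ?_) ?_
  · exact (isAlgebraic_algHom_iff (Algebra.adjoin K G).val Subtype.val_injective).1 (halg _ hg)
  · obtain ⟨k, hk⟩ := hL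
    refine ⟨k, fun x hx => ?_⟩
    have h1 := image_iteratedCommutators (Algebra.adjoin K G).val.toRingHom
      ((Subtype.val : Algebra.adjoin K G → R) ⁻¹' G) k
    have h2 : ((Algebra.adjoin K G).val.toRingHom : Algebra.adjoin K G → R) '' (Subtype.val ⁻¹' G)
      = G := himg
    rw [h2] at h1
    have h3 : (x : R) ∈ iteratedCommutators G k := h1 ▸ ⟨x, hx, rfl⟩
    exact Subtype.ext (hk h3)

/-- A (not necessarily unital) algebra of algebraic elements whose nilpotent elements form a left
ideal containing all commutators. -/
structure IsAlmostCommutative (A : NonUnitalSubalgebra K R) : Prop where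
  comm {x y : R} : x ∈ A → y ∈ A → IsNilpotent (x * y - y * x)
  add {x y : R} : x ∈ A → y ∈ A → IsNilpotent x → IsNilpotent y → IsNilpotent (x + y)
  mul_left {x y : R} : x ∈ A → y ∈ A → IsNilpotent y → IsNilpotent (x * y)
  isAlgebraic {x : R} : x ∈ A → IsAlgebraic K x

theorem IsLocallyLNilpotent.isAlmostCommutative [CharZero K] {F : Set R} (hF : ∀ t ∈ F, IsAlgebraic K t)
    (hL : IsLocallyLNilpotent F) : IsAlmostCommutative (NonUnitalAlgebra.adjoin K F) := by
  have hle : ∀ x ∈ NonUnitalAlgebra.adjoin K F, x ∈ Algebra.adjoin K F := fun x hx =>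
    NonUnitalAlgebra.adjoin_le_algebra_adjoin K F hx
  have key : ∀ x ∈ NonUnitalAlgebra.adjoin K F, ∀ y ∈ NonUnitalAlgebra.adjoin K F,
      ∃ B : Subalgebra K R, x ∈ B ∧ y ∈ B ∧ Module.Finite K B ∧ HasEnoughNilpotents B := by
    intro x hx y hy
    obtain ⟨G, hGF, hG, hxy⟩ := exists_finite_subset_subset_adjoin (K := K) (F := F)
      (s := {x, y}) (by simp) (by
        rintro z (rfl | rfl)
        · exact hle _ hx
        · exact hle _ hy)
    exact ⟨Algebra.adjoin K G, hxy (by simp), hxy (by simp),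
      finite_and_hasEnoughNilpotents_adjoin hG (fun g hg => hF g (hGF hg)) (hL G hGF hG)⟩
  have hnil : ∀ (B : Subalgebra K R) (b : B), IsNilpotent (b : R) ↔ IsNilpotent b := fun B b =>
    IsNilpotent.map_iff (f := B.val) Subtype.val_injective
  refine ⟨fun {x y} hx hy => ?_, fun {x y} hx hy h1 h2 => ?_, fun {x y} hx hy h2 => ?_,
    fun {x} hx => ?_⟩
  · obtain ⟨B, hxB, hyB, -, hB⟩ := key x hx y hy
    exact (hnil B _).2 (hB.comm ⟨x, hxB⟩ ⟨y, hyB⟩)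
  · obtain ⟨B, hxB, hyB, -, hB⟩ := key x hx y hy
    exact (hnil B _).2 (hB.add ((hnil B ⟨x, hxB⟩).1 h1) ((hnil B ⟨y, hyB⟩).1 h2))
  · obtain ⟨B, hxB, hyB, -, hB⟩ := key x hx y hy
    exact (hnil B _).2 (hB.mul_left ⟨x, hxB⟩ ((hnil B ⟨y, hyB⟩).1 h2))
  · obtain ⟨B, hxB, -, hfin, -⟩ := key x hx x hx
    exact (isAlgebraic_algHom_iff B.val Subtype.val_injective).2
      (Algebra.IsAlgebraic.isAlgebraic (R := K) (⟨x, hxB⟩ : B))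

theorem IsLocallyLNilpotent.isLocallyFiniteAlgebra [CharZero K] {F : Set R} (hF : ∀ t ∈ F, IsAlgebraic K t)
    (hL : IsLocallyLNilpotent F) : IsLocallyFiniteAlgebra K (NonUnitalAlgebra.adjoin K F) := by
  rintro _ ⟨s, hs, rfl⟩
  obtain ⟨G, hGF, hG, hsG⟩ := exists_finite_subset_subset_adjoin (K := K) (F := F)
    (hs.image Subtype.val) (by
      rintro _ ⟨x, -, rfl⟩
      exact NonUnitalAlgebra.adjoin_le_algebra_adjoin K F x.2)
  have hfin := (finite_and_hasEnoughNilpotents_adjoin (K := K) hG (fun g hg => hF g (hGF hg))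
    (hL G hGF hG)).1
  have hmem : ∀ x ∈ NonUnitalAlgebra.adjoin K s, (x : R) ∈ Algebra.adjoin K G := by
    intro x hx
    induction hx using NonUnitalAlgebra.adjoin_induction with
    | mem x hx => exact hsG ⟨x, hx, rfl⟩
    | add x y _ _ hx hy => exact add_mem hx hy
    | zero => exact zero_mem _
    | mul x y _ _ hx hy => exact mul_mem hx hy
    | smul r x _ hx => exact Subalgebra.smul_mem _ hx r
  let f : NonUnitalAlgebra.adjoin K s →ₗ[K] Algebra.adjoin K G :=
    { toFun := fun x => ⟨((x : NonUnitalAlgebra.adjoin K F) : R), hmem x x.2⟩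
      map_add' := fun _ _ => rfl
      map_smul' := fun _ _ => rfl }
  refine FiniteDimensional.of_injective f fun x y hxy => ?_
  have h1 := congrArg (Subtype.val : Algebra.adjoin K G → R) hxy
  exact Subtype.ext (Subtype.ext h1)

end LNilpotent

/-! ### Gaps between invariant subspaces and triangularization -/

section Gap

variable {K V : Type*} [Field K] [AddCommGroup V] [Module K V]

/-- The subspaces invariant under a set of operators. -/
def invariantSubspaces (A : Set (Module.End K V)) : Set (Submodule K V) :=
  {M | ∀ T ∈ A, M ≤ M.comap T}

theorem sSup_mem_invariantSubspaces {A : Set (Module.End K V)} {D : Set (Submodule K V)}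
    (hD : D ⊆ invariantSubspaces A) : sSup D ∈ invariantSubspaces A := fun T hT =>
  sSup_le fun _ hM => (hD hM T hT).trans (Submodule.comap_mono (le_sSup hM))

theorem sInf_mem_invariantSubspaces {A : Set (Module.End K V)} {D : Set (Submodule K V)}
    (hD : D ⊆ invariantSubspaces A) : sInf D ∈ invariantSubspaces A := fun T hT _ hx =>
  (Submodule.mem_sInf).2 fun M hM => hD hM T hT ((Submodule.mem_sInf).1 hx M hM)

/-- Peel a linear factor `X - c` off `p`: either `x` is already an eigenvector modulo `M`, or `(a -
c) x` replaces it with the cofactor. -/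
theorem exists_eigenvector_mod [IsAlgClosed K] {a : Module.End K V} {M N : Submodule K V}
    (hN : N ≤ N.comap a) {p : K[X]} (hp : p ≠ 0) {x : V} (hxN : x ∈ N) (hxM : x ∉ M)
    (hpx : aeval a p x ∈ M) : ∃ (c : K) (y : V), y ∈ N ∧ y ∉ M ∧ a y - c • y ∈ M := by
  induction h : p.natDegree generalizing p x with
  | zero =>
    rw [eq_C_of_natDegree_eq_zero h] at hpx hp
    rw [aeval_C, Module.algebraMap_end_apply] at hpx
    exact absurd ((M.smul_mem_iff fun h0 => hp (by rw [h0, C_0])).1 hpx) hxM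
  | succ n ih =>
    obtain ⟨c, hc⟩ := IsAlgClosed.exists_root p (by
      rw [degree_eq_natDegree hp, h]
      exact_mod_cast n.succ_ne_zero)
    obtain ⟨q, rfl⟩ := dvd_iff_isRoot.2 hc
    have hq : q ≠ 0 := right_ne_zero_of_mul hp
    by_cases hy : a x - c • x ∈ M
    · exact ⟨c, x, hxN, hxM, hy⟩
    · refine ih hq (N.sub_mem (hN hxN) (N.smul_mem c hxN)) hy ?_ ?_
      · rw [mul_comm, map_mul, Module.End.mul_apply] at hpx
        simpa using hpx
      · rw [natDegree_mul (X_sub_C_ne_zero c) hq, natDegree_X_sub_C] at h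
        omega

/-- If `0` were the only root, the minimal polynomial would be a power of `X`. -/
theorem exists_eigenvalue_ne_zero [IsAlgClosed K] {a : Module.End K V} (ha : IsAlgebraic K a)
    (hnil : ¬ IsNilpotent a) : ∃ (c : K) (v : V), c ≠ 0 ∧ v ≠ 0 ∧ a v = c • v := by
  have hint : IsIntegral K a := isAlgebraic_iff_isIntegral.1 ha
  have hroot : ∃ c ∈ (minpoly K a).roots, c ≠ 0 := by
    by_contra! h
    have h1 := (IsAlgClosed.splits (minpoly K a)).eq_prod_roots_of_monic (minpoly.monic hint)
    rw [Multiset.eq_replicate.2 ⟨rfl, h⟩, Multiset.map_replicate, Multiset.prod_replicate, C_0,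
      sub_zero] at h1
    have h2 := minpoly.aeval K a
    rw [h1, map_pow, aeval_X] at h2
    exact hnil ⟨_, h2⟩
  obtain ⟨c, hc, hc0⟩ := hroot
  obtain ⟨q, hq⟩ := dvd_iff_isRoot.2 (isRoot_of_mem_roots hc)
  have hp0 : minpoly K a ≠ 0 := minpoly.ne_zero hint
  have hq0 : q ≠ 0 := by
    rintro rfl
    exact hp0 (by rw [hq, mul_zero])
  have hqa : aeval a q ≠ 0 := by
    intro h0
    have h1 := natDegree_le_of_dvd (minpoly.dvd K a h0) hq0
    rw [hq, natDegree_mul (X_sub_C_ne_zero c) hq0, natDegree_X_sub_C] at h1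
    omega
  obtain ⟨w, hw⟩ : ∃ w, aeval a q w ≠ 0 := by
    by_contra! h
    exact hqa (LinearMap.ext h)
  refine ⟨c, aeval a q w, hc0, hw, ?_⟩
  have h1 := LinearMap.congr_fun (minpoly.aeval K a) w
  rw [hq, map_mul, Module.End.mul_apply] at h1
  rw [← sub_eq_zero]
  simpa using h1

variable {A : NonUnitalSubalgebra K (Module.End K V)} {M N : Submodule K V}

theorem IsAlmostCommutative.apply_mem_of_isNilpotent (hA : IsAlmostCommutative A)
    (hM : M ∈ invariantSubspaces (A : Set (Module.End K V)))
    (hN : N ∈ invariantSubspaces (A : Set (Module.End K V))) (hMN : M ≤ N)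
    (hgap : ∀ X ∈ invariantSubspaces (A : Set (Module.End K V)), M ≤ X → X ≤ N → X = M ∨ X = N)
    {j : Module.End K V} (hj : j ∈ A) (hjn : IsNilpotent j) {x : V} (hx : x ∈ N) : j x ∈ M := by
  -- This is `M + J x`, with `J` the nilpotents of `A`. If it were all of `N`, then `x ≡ i x` modulo
  -- `M` for a nilpotent `i`, and iterating would put `x` in `M`.
  let X : Submodule K V :=
    { carrier := {v | ∃ i ∈ A, IsNilpotent i ∧ v - i x ∈ M}
      zero_mem' := ⟨0, zero_mem A, IsNilpotent.zero, by simp⟩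
      add_mem' := by
        rintro v w ⟨i, hi, hin, hv⟩ ⟨k, hk, hkn, hw⟩
        refine ⟨i + k, add_mem hi hk, hA.add hi hk hin hkn, ?_⟩
        have := M.add_mem hv hw
        rwa [sub_add_sub_comm] at this
      smul_mem' := by
        rintro c v ⟨i, hi, hin, hv⟩
        refine ⟨c • i, SMulMemClass.smul_mem c hi, hin.smul c, ?_⟩
        have := M.smul_mem c hv
        rwa [smul_sub] at this }
  have hX : X ∈ invariantSubspaces (A : Set (Module.End K V)) := by
    rintro T hT v ⟨i, hi, hin, hv⟩
    refine ⟨T * i, mul_mem hT hi, hA.mul_left hT hi hin, ?_⟩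
    have := hM T hT hv
    rwa [Submodule.mem_comap, map_sub] at this
  have hjX : j x ∈ X := ⟨j, hj, hjn, by simp⟩
  have hMX : M ≤ X := fun v hv => ⟨0, zero_mem A, IsNilpotent.zero, by simpa using hv⟩
  have hXN : X ≤ N := by
    rintro v ⟨i, hi, -, hv⟩
    have := N.add_mem (hMN hv) (hN i hi hx)
    rwa [sub_add_cancel] at this
  rcases hgap X hX hMX hXN with h | h
  · exact h ▸ hjX
  · obtain ⟨i, hi, ⟨n, hn⟩, hxi⟩ : x ∈ X := h ▸ hx
    have key : ∀ k : ℕ, x - (i ^ k) x ∈ M := by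
      intro k
      induction k with
      | zero => simp
      | succ k ih =>
        have h1 := M.add_mem hxi (hM i hi ih)
        rwa [map_sub, sub_add_sub_cancel, ← Module.End.mul_apply, ← pow_succ'] at h1
    have h2 := key n
    rw [hn, LinearMap.zero_apply, sub_zero] at h2
    exact hM j hj h2

theorem IsAlmostCommutative.exists_scalar [IsAlgClosed K] (hA : IsAlmostCommutative A)
    (hM : M ∈ invariantSubspaces (A : Set (Module.End K V)))
    (hN : N ∈ invariantSubspaces (A : Set (Module.End K V))) (hMN : M ≤ N)
    (hgap : ∀ X ∈ invariantSubspaces (A : Set (Module.End K V)), M ≤ X → X ≤ N → X = M ∨ X = N)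
    {a : Module.End K V} (ha : a ∈ A) : ∃ c : K, ∀ x ∈ N, a x - c • x ∈ M := by
  by_cases hNM : N ≤ M
  · exact ⟨0, fun x hx => by simpa using hM a ha (hNM hx)⟩
  obtain ⟨x, hxN, hxM⟩ := SetLike.not_le_iff_exists.1 hNM
  obtain ⟨p, hp0, hp⟩ := hA.isAlgebraic ha
  obtain ⟨c, y, hyN, hyM, hy⟩ := exists_eigenvector_mod (M := M) (hN a ha) hp0 hxN hxM
    (by rw [hp]; exact M.zero_mem)
  -- The `c`-eigenspace of `a` on `N / M`; it is invariant because commutators act there as zero.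
  let X : Submodule K V := N ⊓ M.comap (a - algebraMap K (Module.End K V) c)
  have hmem : ∀ v, v ∈ X ↔ v ∈ N ∧ a v - c • v ∈ M := fun v => by
    simp [X, Module.algebraMap_end_apply]
  have hX : X ∈ invariantSubspaces (A : Set (Module.End K V)) := by
    intro T hT v hv
    rw [Submodule.mem_comap, hmem]
    rw [hmem] at hv
    refine ⟨hN T hT hv.1, ?_⟩
    have h1 := hA.apply_mem_of_isNilpotent hM hN hMN hgap
      (sub_mem (mul_mem ha hT) (mul_mem hT ha)) (hA.comm ha hT) hv.1
    have h2 := M.add_mem h1 (hM T hT hv.2)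
    rw [map_sub, map_smul, LinearMap.sub_apply, Module.End.mul_apply, Module.End.mul_apply,
      sub_add_sub_cancel] at h2
    exact h2
  have hMX : M ≤ X := fun v hv =>
    (hmem v).2 ⟨hMN hv, M.sub_mem (hM a ha hv) (M.smul_mem c hv)⟩
  rcases hgap X hX hMX inf_le_left with h | h
  · exact absurd (h ▸ (hmem y).2 ⟨hyN, hy⟩) hyM
  · exact ⟨c, fun x hx => ((hmem x).1 (h ▸ hx)).2⟩

theorem IsAlmostCommutative.mem_invariantSubspaces [IsAlgClosed K] (hA : IsAlmostCommutative A)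
    (hM : M ∈ invariantSubspaces (A : Set (Module.End K V)))
    (hN : N ∈ invariantSubspaces (A : Set (Module.End K V)))
    (hgap : ∀ X ∈ invariantSubspaces (A : Set (Module.End K V)), M ≤ X → X ≤ N → X = M ∨ X = N)
    {X : Submodule K V} (hMX : M ≤ X) (hXN : X ≤ N) :
    X ∈ invariantSubspaces (A : Set (Module.End K V)) := by
  intro a ha x hx
  obtain ⟨c, hc⟩ := hA.exists_scalar hM hN (hMX.trans hXN) hgap ha
  have := X.add_mem (hMX (hc x (hXN hx))) (X.smul_mem c hx)
  rwa [sub_add_cancel] at this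

/-- A subspace `X` comparable with a maximal chain `C` of invariant subspaces sits in a gap of `C`;
scalar action makes it invariant, so `X ∈ C`. -/
theorem IsAlmostCommutative.isAlgebraicallyTriangularizable [IsAlgClosed K]
    (hA : IsAlmostCommutative A) :
    IsAlgebraicallyTriangularizable (A : Set (Module.End K V)) := by
  let I := invariantSubspaces (A : Set (Module.End K V))
  obtain ⟨C, ⟨hCchain, hCI⟩, hCmax⟩ := zorn_subset
    {C : Set (Submodule K V) | IsChain (· ≤ ·) C ∧ C ⊆ I} (by
      intro D hD hDchain
      refine ⟨⋃₀ D, ⟨?_, Set.sUnion_subset fun s hs => (hD hs).2⟩,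
        fun s hs => Set.subset_sUnion_of_mem hs⟩
      rintro X ⟨s, hs, hXs⟩ Y ⟨t, ht, hYt⟩ hXY
      rcases hDchain.total hs ht with h | h
      · exact (hD ht).1 (h hXs) hYt hXY
      · exact (hD hs).1 hXs (h hYt) hXY)
  have hmem : ∀ X ∈ I, (∀ Y ∈ C, X ≤ Y ∨ Y ≤ X) → X ∈ C := by
    intro X hX hcomp
    exact hCmax (y := insert X C)
      ⟨hCchain.insert fun Y hY _ => hcomp Y hY, Set.insert_subset hX hCI⟩
      (Set.subset_insert X C) (Set.mem_insert X C)
  refine ⟨C, ⟨hCchain, fun D hD hCD => hCD.antisymm fun X hXD => ?_⟩,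
    fun M hM T hT x hx => hCI hM T hT hx⟩
  have hX : ∀ Y ∈ C, X ≤ Y ∨ Y ≤ X := fun Y hY => hD.total hXD (hCD hY)
  let M := sSup {Y | Y ∈ C ∧ Y ≤ X}
  let N := sInf {Y | Y ∈ C ∧ X ≤ Y}
  have hM : M ∈ I := sSup_mem_invariantSubspaces fun Y hY => hCI hY.1
  have hN : N ∈ I := sInf_mem_invariantSubspaces fun Y hY => hCI hY.1
  have hMX : M ≤ X := sSup_le fun Y hY => hY.2
  have hXN : X ≤ N := le_sInf fun Y hY => hY.2
  refine hmem X (hA.mem_invariantSubspaces hM hN (fun Y hY hMY hYN => ?_) hMX hXN) hX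
  -- No member of `C` lies strictly between `M` and `N` without being comparable to `X`, so `Y` is
  -- comparable with all of `C`.
  have hYC : Y ∈ C := hmem Y hY fun Z hZ => by
    rcases hX Z hZ with h | h
    · exact Or.inl (hYN.trans (sInf_le ⟨hZ, h⟩))
    · exact Or.inr ((le_sSup (show Z ∈ {Y | Y ∈ C ∧ Y ≤ X} from ⟨hZ, h⟩)).trans hMY)
  rcases hX Y hYC with h | h
  · exact Or.inr (hYN.antisymm (sInf_le ⟨hYC, h⟩))
  · exact Or.inl ((le_sSup (show Y ∈ {Y | Y ∈ C ∧ Y ≤ X} from ⟨hYC, h⟩)).antisymm hMY)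

end Gap

/-! ### Characters, primitive ideals and the radical -/

/-- An element outside the kernel of a character lies outside some primitive ideal. -/
theorem exists_isPrimitiveIdeal_notMem.{v, u} {K : Type v} {A : Type u} [Field K]
    [NonUnitalRing A] [Module K A] [IsScalarTower K A A] [SMulCommClass K A A] (χ : A →ₙₐ[K] K)
    {a : A} (ha : χ a ≠ 0) : ∃ P : TwoSidedIdeal A, IsPrimitiveIdeal K P ∧ a ∉ P := by
  have ha0 : a ≠ 0 := by
    rintro rfl
    exact ha (map_zero χ)
  -- A one-dimensional space in the universe of `A`, as primitivity requires; `K` itself may live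
  -- elsewhere.
  let M := Submodule.span K {a}
  have hrank : Module.finrank K M = 1 := finrank_span_singleton ha0
  have hsimple : IsSimpleModule K M := isSimpleModule_iff_finrank_eq_one.2 hrank
  let m : M := ⟨a, Submodule.mem_span_singleton_self a⟩
  have hm : m ≠ 0 := fun h => ha0 (congrArg Subtype.val h)
  let π : A →ₙₐ[K] Module.End K M :=
    { toFun := fun b => χ b • LinearMap.id
      map_smul' := fun c b => by simp [smul_smul]
      map_zero' := by simp
      map_add' := fun b d => by simp [add_smul]
      map_mul' := fun b d => by
        ext x
        simp [smul_smul, mul_comm] }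
  have hπ : ∀ b x, π b x = χ b • x := fun _ _ => rfl
  refine ⟨TwoSidedIdeal.ker π, ⟨M, inferInstance, inferInstance, π,
    ⟨⟨a, m, smul_ne_zero ha hm⟩, fun N _ => eq_bot_or_eq_top N⟩, fun b => ?_⟩, fun h => ?_⟩
  · exact TwoSidedIdeal.mem_ker _
  · have h1 := LinearMap.congr_fun ((TwoSidedIdeal.mem_ker _).1 h) m
    rw [hπ] at h1
    exact smul_ne_zero ha hm h1

section Radical

universe v u

variable {K : Type v} {V : Type u} [Field K] [AddCommGroup V] [Module K V]
  {A : NonUnitalSubalgebra K (Module.End K V)}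

theorem IsAlmostCommutative.apply_eq_zero_of_isNilpotent (hA : IsAlmostCommutative A) {M : Type*}
    [AddCommGroup M] [Module K M] {π : A →ₙₐ[K] Module.End K M} (hπ : IsSimpleRepresentation π)
    {a : A} (ha : IsNilpotent (a : Module.End K V)) : π a = 0 := by
  ext m
  by_contra hm
  rw [LinearMap.zero_apply] at hm
  -- The submodule `J m`, with `J` the nilpotents of `A`. If it is everything, some nilpotent `j`
  -- fixes `m`, which forces `m = 0`.
  let X : Submodule K M :=
    { carrier := {w | ∃ i : A, IsNilpotent (i : Module.End K V) ∧ π i m = w}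
      zero_mem' := ⟨0, IsNilpotent.zero, by simp⟩
      add_mem' := by
        rintro _ _ ⟨i, hi, rfl⟩ ⟨k, hk, rfl⟩
        exact ⟨i + k, hA.add i.2 k.2 hi hk, by simp⟩
      smul_mem' := by
        rintro c _ ⟨i, hi, rfl⟩
        exact ⟨c • i, hi.smul c, by simp⟩ }
  have hX : X = ⊥ ∨ X = ⊤ := by
    refine hπ.2 X ?_
    rintro b _ ⟨i, hi, rfl⟩
    exact ⟨b * i, hA.mul_left b.2 i.2 hi, by simp⟩
  rcases hX with hX | hX
  · have h1 : π a m ∈ X := ⟨a, ha, rfl⟩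
    rw [hX] at h1
    exact hm ((Submodule.mem_bot K).1 h1)
  · obtain ⟨j, ⟨n, hn⟩, hj⟩ : m ∈ X := hX ▸ Submodule.mem_top
    -- Since `A` may lack an identity, only positive powers of `j` are realized in it.
    have key : ∀ k : ℕ, ∃ b : A, (b : Module.End K V) = (j : Module.End K V) ^ (k + 1) ∧
        π b m = m := by
      intro k
      induction k with
      | zero => exact ⟨j, by simp, hj⟩
      | succ k ih =>
        obtain ⟨b, hb, hbm⟩ := ih
        exact ⟨j * b, by rw [pow_succ', ← hb]; rfl, by simp [hbm, hj]⟩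
    obtain ⟨b, hb, hbm⟩ := key n
    rw [pow_succ, hn, zero_mul] at hb
    have hb0 : b = 0 := Subtype.ext hb
    rw [hb0, map_zero, LinearMap.zero_apply] at hbm
    exact hm (by rw [← hbm, map_zero])

/-- Take an eigenvector `v` of `a` with nonzero eigenvalue, and a gap of invariant subspaces
separating `v` from `M`. The scalars by which `A` acts on that gap form the character. -/
theorem IsAlmostCommutative.exists_character [IsAlgClosed K] (hA : IsAlmostCommutative A)
    {a : A} (ha : ¬ IsNilpotent (a : Module.End K V)) : ∃ χ : A →ₙₐ[K] K, χ a ≠ 0 := by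
  obtain ⟨c, v, hc, hv, hav⟩ := exists_eigenvalue_ne_zero (hA.isAlgebraic a.2) ha
  let I := invariantSubspaces (A : Set (Module.End K V))
  obtain ⟨M, ⟨hM, hvM⟩, hmax⟩ := zorn_le₀ {M : Submodule K V | M ∈ I ∧ v ∉ M} (by
    intro D hD hchain
    refine ⟨sSup D, ⟨sSup_mem_invariantSubspaces fun X hX => (hD hX).1, fun hvD => ?_⟩,
      fun X hX => le_sSup hX⟩
    rcases D.eq_empty_or_nonempty with rfl | hne
    · rw [sSup_empty] at hvD
      exact hv ((Submodule.mem_bot K).1 hvD)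
    · obtain ⟨X, hX, hvX⟩ := (Submodule.mem_sSup_of_directed hne hchain.directedOn).1 hvD
      exact (hD hX).2 hvX)
  let N := sInf {X | X ∈ I ∧ M ≤ X ∧ v ∈ X}
  have hN : N ∈ I := sInf_mem_invariantSubspaces fun X hX => hX.1
  have hMN : M ≤ N := le_sInf fun X hX => hX.2.1
  have hvN : v ∈ N := (Submodule.mem_sInf).2 fun X hX => hX.2.2
  have hgap : ∀ X ∈ I, M ≤ X → X ≤ N → X = M ∨ X = N := by
    intro X hX hMX hXN
    by_cases hvX : v ∈ X
    · exact Or.inr (hXN.antisymm (sInf_le ⟨hX, hMX, hvX⟩))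
    · exact Or.inl ((hmax ⟨hX, hvX⟩ hMX).antisymm hMX)
  have hsc : ∀ b : A, ∃ c : K, (b : Module.End K V) v - c • v ∈ M := by
    intro b
    obtain ⟨c, hc⟩ := hA.exists_scalar hM hN hMN hgap b.2
    exact ⟨c, hc v hvN⟩
  have huniq : ∀ (w : V) (c d : K), w - c • v ∈ M → w - d • v ∈ M → c = d := by
    intro w c d h1 h2
    by_contra hcd
    have h3 := M.sub_mem h2 h1
    rw [sub_sub_sub_cancel_left, ← sub_smul] at h3
    exact hvM ((M.smul_mem_iff (sub_ne_zero.2 hcd)).1 h3)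
  choose χ hχ using hsc
  refine ⟨{ toFun := χ, map_smul' := fun c b => ?_, map_zero' := ?_, map_add' := fun b d => ?_,
            map_mul' := fun b d => ?_ }, ?_⟩
  · refine huniq _ _ _ (hχ (c • b)) ?_
    have := M.smul_mem c (hχ b)
    rw [smul_sub, smul_smul] at this
    exact this
  · exact huniq _ _ _ (hχ 0) (by simp)
  · refine huniq _ _ _ (hχ (b + d)) ?_
    have := M.add_mem (hχ b) (hχ d)
    rw [sub_add_sub_comm, ← add_smul] at this
    exact this
  · refine huniq _ _ _ (hχ (b * d)) ?_
    have := M.add_mem (hM b b.2 (hχ d)) (M.smul_mem (χ d) (hχ b))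
    rw [map_sub, map_smul, smul_sub, smul_smul, sub_add_sub_cancel, mul_comm] at this
    exact this
  · have h1 : χ a = c := huniq _ _ _ (hχ a) (by rw [hav, sub_self]; exact M.zero_mem)
    change χ a ≠ 0
    rwa [h1]

theorem IsAlmostCommutative.mem_jacobsonRadical_iff [IsAlgClosed K] (hA : IsAlmostCommutative A)
    (a : A) : a ∈ jacobsonRadical K A ↔ IsNilpotent (a : Module.End K V) := by
  rw [jacobsonRadical, TwoSidedIdeal.mem_sInf]
  constructor
  · intro h
    by_contra hn
    obtain ⟨χ, hχ⟩ := hA.exists_character hn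
    obtain ⟨P, hP, haP⟩ := exists_isPrimitiveIdeal_notMem χ hχ
    exact haP (h P hP)
  · rintro hn P ⟨M, _, _, π, hπ, hP⟩
    exact (hP a).2 (hA.apply_eq_zero_of_isNilpotent hπ hn)

theorem IsAlmostCommutative.mul_comm_quotient_jacobsonRadical [IsAlgClosed K]
    (hA : IsAlmostCommutative A) (x y : (jacobsonRadical K A).ringCon.Quotient) :
    x * y = y * x := by
  obtain ⟨a, rfl⟩ := Quotient.mk''_surjective x
  obtain ⟨b, rfl⟩ := Quotient.mk''_surjective y
  refine (RingCon.eq (jacobsonRadical K A).ringCon (a := a * b) (b := b * a)).2 ?_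
  rw [TwoSidedIdeal.rel_iff, hA.mem_jacobsonRadical_iff]
  exact hA.comm a.2 b.2

end Radical

theorem corollary3p4 {V : Type*} [AddCommGroup V] [Module ℂ V]
    (F : Set (Module.End ℂ V)) (hF : ∀ T ∈ F, IsAlgebraic ℂ T) (hL : IsLocallyLNilpotent F)
    (A : NonUnitalSubalgebra ℂ (Module.End ℂ V)) (hA : A = NonUnitalAlgebra.adjoin ℂ F) :
    IsLocallyFiniteAlgebra ℂ A ∧
    (∀ x y : (jacobsonRadical ℂ A).ringCon.Quotient, x * y = y * x) ∧
    {T : A | T ∈ jacobsonRadical ℂ A} = {T : A | IsNilpotent (T : Module.End ℂ V)} ∧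
    IsAlgebraicallyTriangularizable (A : Set (Module.End ℂ V)) := by
  subst hA
  have h := hL.isAlmostCommutative hF
  exact ⟨hL.isLocallyFiniteAlgebra hF, h.mul_comm_quotient_jacobsonRadical,
    Set.ext h.mem_jacobsonRadical_iff, h.isAlgebraicallyTriangularizable⟩
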